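/- Let $\mathcal X$ be a set with a distinguished "null" element $\bot$. For $x,x'\in\mathcal X^n$ let $|x|$ be the number of $i\in[n]$ with $x_i\ne\bot$; let $(x\setminus x')_i=\bot$ if $x_i=x'_i$ and $(x\setminus x')_i=x_i$ otherwise; for $S\subseteq[n]$ let $(x_S)_i=x_i$ if $i\in S$ and $(x_S)_i=\bot$ otherwise. Call $x,x'$ neighbouring if $|x\setminus x'|+|x'\setminus x|=1$. A randomised algorithm $M:\mathcal X^n\to\mathcal Y$ is $\rho$-zCDP if $D_\alpha(M(x)\,\|\,M(x'))\le\rho\alpha$ for all neighbouring $x,x'$ and all $\alpha\in(1,\infty)$, where $D_\alpha$ is the Rényi divergence. It is $\mu$-GDP if $T(M(x),M(x'))(a)\ge T(\mathcal N(0,1),\mathcal N(\mu,1))(a)$ for all neighbouring $x,x'$ and all $a\in[0,1]$, where $T(P,Q)(a)=\inf\{1-\mathbb E_Q[\varphi]:\varphi \text{ measurable with values in }[0,1],\ \mathbb E_P[\varphi]\le a\}$. For $t\le m\le n$, an $(n,m,t)$-covering design of size $k$ is a family $S_1,\dots,S_k\subseteq[n]$ (repetitions allowed) of sets of size $m$ such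 that every $T\subseteq[n]$ with $|T|\le t$ is contained in some $S_i$. Let $C(n,m,t)$ be the smallest $k$ for which one exists. **Theorem.** There are a universal constant $C>0$ and a function $(N,\rho,\beta)\mapsto t(N,\rho,\beta)\in\mathbb N$ with $$t(N,\rho,\beta)\le C\sqrt{\tfrac1\rho\log\tfrac N\beta}\qquad(N\ge1,\ \rho,\beta>0)$$ (the square root of a negative number being read as $0$) such that the following holds. Let $\mathcal X$ be as above, $\mathcal Y\subseteq\mathbb R$ finite and nonempty, $\rho,\beta>0$, and $t=t(|\mathcal Y|,\rho,\beta)$. Let $n\ge m\ge t$ and $k\ge C(n,m,t)$ be integers. Then an $(n,m,t)$-covering design of size $k$ exists, and for every such design $S_1,\dots,S_k$ there is a randomised map $A:\mathcal Y^k\to\mathcal Y$ such that, for every $f:\mathcal X^n\to\mathcal Y$, there is a randomised algorithm $M:\mathcal X^n\to\mathcal Y$ with the following properties. - **Privacy.** $M$ is $\rho$-zCDP and $\sqrt{2\rho}$-GDP. - **Accuracy.** For every $x\in\mathcal X^n$ with $|x|=n$, $$\Pr\Big[\max_{i\in[k]}f(x_{[n]\setminus S_i})\ \ge\ M(x)\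 \ge\ \min_{i\in[k]}f(x_{[n]\setminus S_i})\Big]\ \ge\ 1-\beta.$$ - **Oracle efficiency.** $M(x)$ depends on $f$ and $x$ only through the $k$ values $f(x_{[n]\setminus S_i})$: for every $x\in\mathcal X^n$, $M(x)$ has the same distribution as $A\big(f(x_{[n]\setminus S_1}),\dots,f(x_{[n]\setminus S_k})\big)$. -/

import Mathlib

open MeasureTheory ProbabilityTheory

noncomputable section

/-! ### Tuples with a null entry

A data set is a tuple `x : Fin n → X`; the element `bot : X` marks a missing entry. -/

/-- The size `|x|`: the number of non-null entries. -/
def tupleSize {X : Type*} {n : ℕ} (bot : X) (x : Fin n → X) : ℕ :=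
  {i : Fin n | x i ≠ bot}.ncard

open Classical in
/-- The difference `x \ x'`: entries on which `x` and `x'` agree are replaced by the null element. -/
def tupleDiff {X : Type*} {n : ℕ} (bot : X) (x x' : Fin n → X) : Fin n → X :=
  fun i => if x i = x' i then bot else x i

/-- The tuple `x_S`: entries outside `S` are replaced by the null element. -/
def tupleRestrict {X : Type*} {n : ℕ} (bot : X) (x : Fin n → X) (S : Finset (Fin n)) :
    Fin n → X :=
  fun i => if i ∈ S then x i else bot

/-- Neighbouring data sets (addition or removal of one entry): `|x \ x'| + |x' \ x| = 1`. -/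
def Neighbouring {X : Type*} {n : ℕ} (bot : X) (x x' : Fin n → X) : Prop :=
  tupleSize bot (tupleDiff bot x x') + tupleSize bot (tupleDiff bot x' x) = 1

/-! ### Concentrated differential privacy -/

/-- The Rényi divergence `D_α(P ‖ Q) = (α - 1)⁻¹ log ∑ y, P(y)^α Q(y)^(1-α)` of order `α > 1`.
In `ℝ≥0∞` a term with `P(y) = 0` is `0` and a term with `P(y) > 0 = Q(y)` is `∞`, so the value
is `⊤` when `P` is not absolutely continuous with respect to `Q`. -/
def renyiDiv {Ω : Type*} (α : ℝ) (P Q : PMF Ω) : EReal :=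
  (((α - 1)⁻¹ : ℝ) : EReal) * ENNReal.log (∑' y, P y ^ α * Q y ^ (1 - α))

/-- `ρ`-zCDP: `D_α(M(x) ‖ M(x')) ≤ ρ α` for all neighbouring `x, x'` and all `α ∈ (1, ∞)`. -/
def IsZCDP {X Ω : Type*} {n : ℕ} (bot : X) (ρ : ℝ) (M : (Fin n → X) → PMF Ω) : Prop :=
  ∀ x x' : Fin n → X, Neighbouring bot x x' →
    ∀ α : ℝ, 1 < α → renyiDiv α (M x) (M x') ≤ ((ρ * α : ℝ) : EReal)

/-! ### Gaussian differential privacy -/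

/-- The trade-off function `T(P, Q)`: the smallest type II error `1 - E_Q[φ]` over all
(randomised) tests `φ` of `P` against `Q` whose type I error `E_P[φ]` is at most `a`. -/
def tradeoff {Ω : Type*} [MeasurableSpace Ω] (P Q : Measure Ω) (a : ℝ) : ℝ :=
  sInf {b : ℝ | ∃ φ : Ω → ℝ, Measurable φ ∧ (∀ ω, 0 ≤ φ ω ∧ φ ω ≤ 1) ∧
    ∫ ω, φ ω ∂P ≤ a ∧ b = 1 - ∫ ω, φ ω ∂Q}

/-- `μ`-GDP: `T(M(x), M(x')) ≥ T(N(0,1), N(μ,1))` pointwise on `[0, 1]`, for all neighbouring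
`x, x'`. -/
def IsGDP {X Ω : Type*} [MeasurableSpace Ω] {n : ℕ} (bot : X) (μ : ℝ)
    (M : (Fin n → X) → PMF Ω) : Prop :=
  ∀ x x' : Fin n → X, Neighbouring bot x x' → ∀ a ∈ Set.Icc (0 : ℝ) 1,
    tradeoff (gaussianReal 0 1) (gaussianReal μ 1) a ≤
      tradeoff (M x).toMeasure (M x').toMeasure a

/-! ### Covering designs -/

/-- `S_1, …, S_k ⊆ [n]` is an `(n, m, t)`-covering design: every `S_i` has size `m`, and every
`T ⊆ [n]` of size at most `t` is contained in some `S_i`. -/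
def IsCoveringDesign (n m t : ℕ) {k : ℕ} (S : Fin k → Finset (Fin n)) : Prop :=
  (∀ i, (S i).card = m) ∧ ∀ T : Finset (Fin n), T.card ≤ t → ∃ i, T ⊆ S i

/-- `C(n, m, t)`: the smallest size of an `(n, m, t)`-covering design. -/
def coveringNumber (n m t : ℕ) : ℕ :=
  sInf {k : ℕ | ∃ S : Fin k → Finset (Fin n), IsCoveringDesign n m t S}

end

/-!
The mechanism is a noisy binary search over `Y`.

For a vector `v` of the `k` values and a set `D` of outputs, let the score of `D` be the least size
of a set `T ⊆ [n]` such that `v i ∈ D` whenever `T ⊆ S i`, capped at `t + 1` (`coverScore`). If two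
data sets differ only at index `j`, their values agree on all blocks containing `j`, so adding `j`
to `T` shows that the score changes by at most `1`. The score vanishes when all values lie in `D`,
and the covering property forces it to be `t + 1` when no value does. Hence the scores of the
initial segments of `Y` decrease from `t + 1` below the smallest value to `0` beyond the largest
one, and it is enough to find, privately, a point of `Y` in neither of these two outer parts.

The search keeps a weight on every element of `Y` and always queries a weighted median `m`: two
Gaussian threshold bits compare the scores of `Iio m` and `Iic m` with `(t + 1) / 2`, and the weights
are updated multiplicatively. In the outer parts the bits are reliable, because `t + 1` is a large
multiple of the standard deviation of the noise. Elsewhere each bit still points towards the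
crossing point `c` of the level `(t + 1) / 2` with probability at least `1/2`. The total weight never
grows, so the inverse weight of `c` is bounded below, while it shrinks on average by a constant
factor at each query in an outer part and grows by less than the inverse of that factor at any other
query. Therefore, except with probability `|Y| (124/125) ^ L`, fewer than half of the `L` queries lie
in the outer parts, and the median of all queries is an accurate output
(`tsum_searchStep_mul_searchPotential_le`, `one_sub_le_searchOutput`). This bound is at most `β` for
some `L = O(log (|Y| / β))`, with no extra factor for a union bound over the steps.

For privacy, `GaussSim μ P Q` says that `P` and `Q` are the images of `N(0,1)` and `N(μ,1)` under one
Markov kernel. It holds for a threshold bit whose mean moves by at most `μ` (`gaussSim_gaussBit`),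
the squares of the shifts add up under adaptive composition by the rotation invariance of the
Gaussian measure (`GaussSim.bind`), and it implies the Gaussian bounds on the trade-off function and
on the Rényi divergence (`GaussSim.tradeoff_le`, `GaussSim.renyiDiv_le`). With `2 L` bits of shift
`√(ρ / L)` each, the total shift is `√(2 ρ)`.
-/

open scoped ENNReal

/-! ### Simulation by a Gaussian shift -/

/-- The law on `Ω` obtained by first drawing `z` from `γ` and then drawing from `k z`. -/
noncomputable def mixture {W Ω : Type*} [MeasurableSpace W] [Countable Ω] (γ : Measure W)
    [IsProbabilityMeasure γ] (k : W → PMF Ω) (hk : ∀ ω, Measurable fun z => k z ω) : PMF Ω :=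
  ⟨fun ω => ∫⁻ z, k z ω ∂γ, by
    have h : ∑' ω, ∫⁻ z, k z ω ∂γ = 1 := by
      rw [← lintegral_tsum fun ω => (hk ω).aemeasurable]
      simp [PMF.tsum_coe]
    exact h ▸ ENNReal.summable.hasSum⟩

lemma mixture_apply {W Ω : Type*} [MeasurableSpace W] [Countable Ω] (γ : Measure W)
    [IsProbabilityMeasure γ] (k : W → PMF Ω) (hk : ∀ ω, Measurable fun z => k z ω) (ω : Ω) :
    mixture γ k hk ω = ∫⁻ z, k z ω ∂γ := rfl

/-- The pair `(P, Q)` is the image of `(N(0,1), N(μ,1))` under one Markov kernel from `ℝ` to `Ω`. -/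
def GaussSim {Ω : Type*} (μ : ℝ) (P Q : PMF Ω) : Prop :=
  ∃ k : ℝ → PMF Ω, (∀ ω, Measurable fun z => k z ω) ∧
    (∀ ω, P ω = ∫⁻ z, k z ω ∂gaussianReal 0 1) ∧ ∀ ω, Q ω = ∫⁻ z, k z ω ∂gaussianReal μ 1

lemma GaussSim.refl {Ω : Type*} (μ : ℝ) (P : PMF Ω) : GaussSim μ P P :=
  ⟨fun _ => P, fun _ => measurable_const, by simp, by simp⟩

lemma lintegral_gaussianReal_eq_shift (m : ℝ) {f : ℝ → ℝ≥0∞} (hf : Measurable f) :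
    ∫⁻ z, f z ∂gaussianReal m 1 = ∫⁻ z, f (z + m) ∂gaussianReal 0 1 := by
  have h := gaussianReal_map_add_const (μ := 0) (v := 1) m
  rw [zero_add] at h
  rw [← h, lintegral_map hf (by fun_prop)]

/-- Rotation invariance of the standard Gaussian measure on the plane, for a shifted mean. -/
lemma lintegral_gaussianReal_rotation (μ θ : ℝ) {F : ℝ × ℝ → ℝ≥0∞} (hF : Measurable F) :
    ∫⁻ z, ∫⁻ w, F (Real.cos θ * z + Real.sin θ * w, -Real.sin θ * z + Real.cos θ * w)
        ∂gaussianReal 0 1 ∂gaussianReal μ 1 =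
      ∫⁻ x, ∫⁻ y, F (x, y) ∂gaussianReal (-Real.sin θ * μ) 1 ∂gaussianReal (Real.cos θ * μ) 1 := by
  have hm : ∀ L : StrongDual ℝ ℝ, (gaussianReal 0 1)[L] = 0 := fun L => by
    rw [integral_continuousLinearMap_gaussianReal]; simp
  have hrot := IsGaussian.map_rotation_eq_self_of_forall_strongDual_eq_zero hm θ
  rw [lintegral_gaussianReal_eq_shift μ (Measurable.lintegral_prod_right' (f := fun p : ℝ × ℝ =>
    F (Real.cos θ * p.1 + Real.sin θ * p.2, -Real.sin θ * p.1 + Real.cos θ * p.2)) (by fun_prop)),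
    lintegral_gaussianReal_eq_shift _ (Measurable.lintegral_prod_right' (f := F) hF)]
  have hy : ∀ x, ∫⁻ y, F (x, y) ∂gaussianReal (-Real.sin θ * μ) 1 =
      ∫⁻ y, F (x, y + -Real.sin θ * μ) ∂gaussianReal 0 1 := fun x =>
    lintegral_gaussianReal_eq_shift _ (hF.comp measurable_prodMk_left)
  simp_rw [hy]
  rw [lintegral_lintegral (f := fun z w => F (Real.cos θ * (z + μ) + Real.sin θ * w,
      -Real.sin θ * (z + μ) + Real.cos θ * w)) (by fun_prop),
    lintegral_lintegral (f := fun x y => F (x + Real.cos θ * μ, y + -Real.sin θ * μ))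
      (by fun_prop)]
  conv_rhs => rw [← hrot]
  rw [lintegral_map (by fun_prop) (by fun_prop)]
  refine lintegral_congr fun p => ?_
  simp only [ContinuousLinearMap.rotation_apply, smul_eq_mul]
  congr 2 <;> ring

lemma lintegral_gaussianReal_projection (μ θ : ℝ) {f : ℝ → ℝ≥0∞} (hf : Measurable f) :
    ∫⁻ z, ∫⁻ w, f (Real.cos θ * z + Real.sin θ * w) ∂gaussianReal 0 1 ∂gaussianReal μ 1 =
      ∫⁻ x, f x ∂gaussianReal (Real.cos θ * μ) 1 := by
  have := lintegral_gaussianReal_rotation μ θ (hf.comp measurable_fst)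
  simpa using this

/-- Adaptive composition: a Gaussian pair with shift `(s, r)` in the plane is, after a rotation, a
pair on the line with shift `√(s² + r²)` and an independent coordinate without shift. -/
lemma GaussSim.bind {A Ω : Type*} [Countable A] [Countable Ω] {s r : ℝ} {P Q : PMF A}
    {P' Q' : A → PMF Ω} (h : GaussSim s P Q) (h' : ∀ a, GaussSim r (P' a) (Q' a)) :
    GaussSim (Real.sqrt (s ^ 2 + r ^ 2)) (P.bind P') (Q.bind Q') := by
  obtain ⟨k, hk, hP, hQ⟩ := h
  choose k' hk' hP' hQ' using h'
  set μ := Real.sqrt (s ^ 2 + r ^ 2) with hμ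
  obtain ⟨θ, hc, hs⟩ : ∃ θ : ℝ, Real.cos θ * μ = s ∧ -Real.sin θ * μ = r := by
    refine ⟨Complex.arg ⟨s, -r⟩, ?_, ?_⟩
    · have := Complex.norm_mul_cos_arg ⟨s, -r⟩
      rw [Complex.norm_eq_sqrt_sq_add_sq, neg_sq] at this
      rw [mul_comm]; exact this
    · have := Complex.norm_mul_sin_arg ⟨s, -r⟩
      rw [Complex.norm_eq_sqrt_sq_add_sq, neg_sq] at this
      simp only at this
      linarith [mul_comm (Real.sin (Complex.arg ⟨s, -r⟩)) μ]
  -- the composed kernel on the plane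
  let G : ℝ × ℝ → PMF Ω := fun p => (k p.1).bind fun a => k' a p.2
  have hG : ∀ ω, Measurable fun p => G p ω := fun ω => by
    simp only [G, PMF.bind_apply]
    exact Measurable.tsum fun a => ((hk a).comp measurable_fst).mul
      ((hk' a ω).comp measurable_snd)
  have hR : Measurable fun p : ℝ × ℝ => (Real.cos θ * p.1 + Real.sin θ * p.2,
    -Real.sin θ * p.1 + Real.cos θ * p.2) := by fun_prop
  have key : ∀ (m m' : ℝ) (ω : Ω) (R : PMF A) (R' : A → PMF Ω),
      (∀ a, R a = ∫⁻ z, k z a ∂gaussianReal m 1) →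
      (∀ a ω, R' a ω = ∫⁻ z, k' a z ω ∂gaussianReal m' 1) →
      R.bind R' ω = ∫⁻ x, ∫⁻ y, G (x, y) ω ∂gaussianReal m' 1 ∂gaussianReal m 1 := by
    intro m m' ω R R' hR hR'
    simp only [G, PMF.bind_apply, hR, hR']
    have h1 : ∀ x, ∫⁻ y, ∑' a, k x a * k' a y ω ∂gaussianReal m' 1 =
        ∑' a, k x a * ∫⁻ y, k' a y ω ∂gaussianReal m' 1 := fun x => by
      rw [lintegral_tsum fun a => ((hk' a ω).const_mul _).aemeasurable]
      exact tsum_congr fun a => lintegral_const_mul _ (hk' a ω)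
    simp_rw [h1]
    rw [lintegral_tsum fun a => ((hk a).mul_const _).aemeasurable]
    exact tsum_congr fun a => (lintegral_mul_const _ (hk a)).symm
  refine ⟨fun z => mixture (gaussianReal 0 1) (fun w => G (Real.cos θ * z + Real.sin θ * w,
    -Real.sin θ * z + Real.cos θ * w)) fun ω => (hG ω).comp (hR.comp measurable_prodMk_left),
    fun ω => ?_, fun ω => ?_, fun ω => ?_⟩
  · exact Measurable.lintegral_prod_right' (f := fun p : ℝ × ℝ =>
      G (Real.cos θ * p.1 + Real.sin θ * p.2, -Real.sin θ * p.1 + Real.cos θ * p.2) ω)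
      ((hG ω).comp hR)
  · rw [key 0 0 ω P P' hP hP']
    simp only [mixture_apply]
    have := lintegral_gaussianReal_rotation 0 θ (hG ω)
    simpa using this.symm
  · rw [key s r ω Q Q' hQ hQ']
    simp only [mixture_apply]
    have := lintegral_gaussianReal_rotation μ θ (hG ω)
    rw [hc, hs] at this
    exact this.symm

lemma GaussSim.map {A Ω : Type*} [Countable A] [Countable Ω] {s : ℝ} (hs : 0 ≤ s) {P Q : PMF A}
    (h : GaussSim s P Q) (g : A → Ω) : GaussSim s (P.map g) (Q.map g) := by
  have := h.bind (r := 0) (P' := PMF.pure ∘ g) (Q' := PMF.pure ∘ g) fun a => GaussSim.refl 0 _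
  simpa [Real.sqrt_sq hs, PMF.bind_pure_comp] using this

/-! ### Gaussian threshold bits -/

lemma measurable_pure_decide_pos_add (h : ℝ) (b : Bool) :
    Measurable fun z : ℝ => PMF.pure (decide (0 < h + z)) b :=
  (measurable_of_finite fun c : Bool => PMF.pure c b).comp <| measurable_to_bool <| by
    have : (fun z : ℝ => decide (0 < h + z)) ⁻¹' {true} = Set.Ioi (-h) := by
      ext z; simp [neg_lt_iff_pos_add']
    rw [this]; exact measurableSet_Ioi

/-- The random bit `1[h + Z > 0]` with `Z` standard Gaussian. -/
noncomputable def gaussBit (h : ℝ) : PMF Bool :=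
  mixture (gaussianReal 0 1) (fun z => PMF.pure (decide (0 < h + z)))
    (measurable_pure_decide_pos_add h)

lemma gaussSim_gaussBit {h h' s : ℝ} (hs : 0 < s) (hh : |h' - h| ≤ s) :
    GaussSim s (gaussBit h) (gaussBit h') := by
  -- a shift by `h' - h = s * cos θ` is the first coordinate of a shift by `s` in the plane
  set c := (h' - h) / s with hc
  have hc1 : |c| ≤ 1 := by rw [hc, abs_div, abs_of_pos hs]; exact (div_le_one hs).2 hh
  have hcos : Real.cos (Real.arccos c) = c := Real.cos_arccos (abs_le.1 hc1).1 (abs_le.1 hc1).2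
  set θ := Real.arccos c
  have hcs : c * s = h' - h := div_mul_cancel₀ _ hs.ne'
  have hR : Measurable fun p : ℝ × ℝ => Real.cos θ * p.1 + Real.sin θ * p.2 := by fun_prop
  have hb := measurable_pure_decide_pos_add h
  refine ⟨fun z => mixture (gaussianReal 0 1)
    (fun w => PMF.pure (decide (0 < h + (Real.cos θ * z + Real.sin θ * w))))
    fun b => ((hb b).comp hR).comp measurable_prodMk_left, fun b => ?_, fun b => ?_, fun b => ?_⟩
  · exact Measurable.lintegral_prod_right' ((hb b).comp hR)
  · have := lintegral_gaussianReal_projection 0 θ (hb b)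
    rw [mul_zero] at this
    exact this.symm
  · have := lintegral_gaussianReal_projection s θ (hb b)
    rw [hcos, hcs, lintegral_gaussianReal_eq_shift _ (hb b)] at this
    simp only [mixture_apply, gaussBit, hcos]
    rw [this]
    refine lintegral_congr fun z => ?_
    rw [show h + (z + (h' - h)) = h' + z by ring]

lemma toReal_gaussBit_true (h : ℝ) :
    (gaussBit h true).toReal = cdf (gaussianReal 0 1) h := by
  have h1 : gaussBit h true = gaussianReal 0 1 (Set.Ioi (-h)) := by
    rw [gaussBit, mixture_apply, ← lintegral_indicator_one measurableSet_Ioi]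
    refine lintegral_congr fun z => ?_
    by_cases hz : 0 < h + z
    · simp [hz, Set.indicator, neg_lt_iff_pos_add'.2 hz]
    · have : ¬ -h < z := fun h' => hz (neg_lt_iff_pos_add'.1 h')
      simp [hz, Set.indicator, this]
  have hneg : (gaussianReal 0 1).map (fun x => -x) = gaussianReal 0 1 := by
    rw [gaussianReal_map_neg, neg_zero]
  have h2 : gaussianReal 0 1 (Set.Ioi (-h)) = gaussianReal 0 1 (Set.Iio h) := by
    conv_rhs => rw [← hneg]
    rw [Measure.map_apply measurable_neg measurableSet_Iio]
    congr 1; ext z; simp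
  have := nullSingletonClass_gaussianReal (μ := 0) (v := 1) one_ne_zero
  rw [h1, h2, measure_congr Iio_ae_eq_Iic, cdf_eq_real, measureReal_def]

lemma toReal_gaussBit_false (h : ℝ) :
    (gaussBit h false).toReal = 1 - (gaussBit h true).toReal := by
  have := (gaussBit h).tsum_coe
  rw [tsum_bool] at this
  have := congrArg ENNReal.toReal this
  rw [ENNReal.toReal_add (PMF.apply_ne_top _ _) (PMF.apply_ne_top _ _)] at this
  simp at this; linarith

lemma toReal_gaussBit_true_mono : Monotone fun h => (gaussBit h true).toReal := by
  simp_rw [toReal_gaussBit_true]; exact monotone_cdf _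

lemma toReal_gaussBit_true_zero : (gaussBit 0 true).toReal = 1 / 2 := by
  have h1 : gaussBit 0 true = gaussianReal 0 1 (Set.Ioi 0) := by
    rw [gaussBit, mixture_apply, ← lintegral_indicator_one measurableSet_Ioi]
    refine lintegral_congr fun z => ?_
    by_cases hz : 0 < z <;> simp [hz, Set.indicator]
  have h2 := toReal_gaussBit_true 0
  rw [cdf_eq_real] at h2
  have h3 := probReal_compl_eq_one_sub (μ := gaussianReal 0 1) (measurableSet_Iic (a := (0 : ℝ)))
  rw [Set.compl_Iic, measureReal_def, ← h1] at h3
  linarith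

/-- A threshold bit whose mean is at a large enough margin from `0` is correct with high
probability. -/
lemma exists_gaussBit_reliable : ∃ D : ℝ, 0 < D ∧
    (∀ h, D ≤ h → 99 / 100 ≤ (gaussBit h true).toReal) ∧
    ∀ h, h ≤ -D → (gaussBit h true).toReal ≤ 1 / 100 := by
  obtain ⟨D₁, h₁⟩ := Filter.eventually_atTop.1
    ((tendsto_cdf_atTop (gaussianReal 0 1)).eventually_const_le (by norm_num : (99 / 100 : ℝ) < 1))
  obtain ⟨D₂, h₂⟩ := Filter.eventually_atBot.1
    ((tendsto_cdf_atBot (gaussianReal 0 1)).eventually_le_const (by norm_num : (0 : ℝ) < 1 / 100))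
  refine ⟨max 1 (max D₁ (-D₂)), by positivity, fun h hh => ?_, fun h hh => ?_⟩ <;>
    rw [toReal_gaussBit_true]
  · exact h₁ h (by simp at hh; linarith)
  · have := le_max_right (1 : ℝ) (max D₁ (-D₂))
    have := le_max_right D₁ (-D₂)
    exact h₂ h (by linarith)

/-! ### Privacy guarantees of a Gaussian simulation -/

lemma GaussSim.tradeoff_le {Ω : Type*} [Fintype Ω] [MeasurableSpace Ω] [MeasurableSingletonClass Ω]
    {μ : ℝ} {P Q : PMF Ω} (h : GaussSim μ P Q) {a : ℝ} (ha : 0 ≤ a) :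
    tradeoff (gaussianReal 0 1) (gaussianReal μ 1) a ≤ tradeoff P.toMeasure Q.toMeasure a := by
  obtain ⟨k, hk, hP, hQ⟩ := h
  have hk' : ∀ y, Measurable fun z => (k z y).toReal := fun y => (hk y).ennreal_toReal
  have hk1 : ∀ z y, (k z y).toReal ≤ 1 := fun z y =>
    ENNReal.toReal_le_of_le_ofReal zero_le_one (by simpa using (k z).coe_le_one y)
  have hint : ∀ m y, Integrable (fun z => (k z y).toReal) (gaussianReal m 1) := fun m y =>
    Integrable.of_bound (hk' y).aestronglyMeasurable 1 <| .of_forall fun z => by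
      simpa [abs_of_nonneg ENNReal.toReal_nonneg] using hk1 z y
  have hsum : ∀ z, ∑ y, (k z y).toReal = 1 := fun z => by
    rw [← ENNReal.toReal_sum fun y _ => PMF.apply_ne_top _ _,
      ← tsum_fintype (L := .unconditional _), PMF.tsum_coe]
    simp
  -- a test on `Ω` pulls back along the kernel to a test on `ℝ` with the same errors
  have pull : ∀ (m : ℝ) (R : PMF Ω), (∀ y, R y = ∫⁻ z, k z y ∂gaussianReal m 1) → ∀ φ : Ω → ℝ,
      ∫ z, ∑ y, (k z y).toReal * φ y ∂gaussianReal m 1 = ∫ y, φ y ∂(R.toMeasure) := by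
    intro m R hR φ
    rw [integral_finsetSum _ fun y _ => (hint m y).mul_const _, PMF.integral_eq_sum]
    refine Finset.sum_congr rfl fun y _ => ?_
    rw [integral_mul_const, smul_eq_mul, hR, integral_toReal (hk y).aemeasurable]
    exact .of_forall fun z => (PMF.apply_lt_top _ _)
  refine csInf_le_csInf ⟨0, ?_⟩ ⟨1, fun _ => 0, measurable_const, by simp, by simpa, by simp⟩ ?_
  · rintro _ ⟨φ, hφ, hφ01, -, rfl⟩
    have : ∫ ω, φ ω ∂gaussianReal μ 1 ≤ ∫ _, 1 ∂gaussianReal μ 1 :=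
      integral_mono_of_nonneg (.of_forall fun ω => (hφ01 ω).1) (integrable_const _)
        (.of_forall fun ω => (hφ01 ω).2)
    simp at this; linarith
  · rintro _ ⟨φ, -, hφ01, hφa, rfl⟩
    refine ⟨fun z => ∑ y, (k z y).toReal * φ y,
      Finset.measurable_sum _ fun y _ => (hk' y).mul_const _, fun z => ⟨?_, ?_⟩, ?_, ?_⟩
    · exact Finset.sum_nonneg fun y _ => mul_nonneg ENNReal.toReal_nonneg (hφ01 y).1
    · rw [← hsum z]
      exact Finset.sum_le_sum fun y _ => mul_le_of_le_one_right ENNReal.toReal_nonneg (hφ01 y).2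
    · rwa [pull 0 P hP]
    · rw [pull μ Q hQ]

/-- The density of `N(0,1)` with respect to `N(μ,1)`. -/
noncomputable def gaussRatio (μ z : ℝ) : ℝ≥0∞ := ENNReal.ofReal (Real.exp (μ ^ 2 / 2 - μ * z))

lemma measurable_gaussRatio (μ : ℝ) : Measurable (gaussRatio μ) := by
  unfold gaussRatio; fun_prop

lemma lintegral_gaussianReal_zero (μ : ℝ) {f : ℝ → ℝ≥0∞} (hf : Measurable f) :
    ∫⁻ z, f z ∂gaussianReal 0 1 = ∫⁻ z, f z * gaussRatio μ z ∂gaussianReal μ 1 := by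
  rw [gaussianReal_of_var_ne_zero _ one_ne_zero, gaussianReal_of_var_ne_zero _ one_ne_zero,
    lintegral_withDensity_eq_lintegral_mul _ (measurable_gaussianPDF _ _) hf,
    lintegral_withDensity_eq_lintegral_mul _ (measurable_gaussianPDF _ _)
      (g := fun z => f z * gaussRatio μ z) (hf.mul (measurable_gaussRatio μ))]
  refine lintegral_congr fun z => ?_
  have : gaussianPDF 0 1 z = gaussianPDF μ 1 z * gaussRatio μ z := by
    rw [gaussianPDF, gaussianPDF, gaussRatio, ← ENNReal.ofReal_mul (gaussianPDFReal_nonneg _ _ _),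
      gaussianPDFReal, gaussianPDFReal, mul_assoc _ (Real.exp _), ← Real.exp_add]
    congr 3
    push_cast; ring
  simp only [Pi.mul_apply, this]; ring

lemma lintegral_gaussRatio_rpow (μ α : ℝ) :
    ∫⁻ z, gaussRatio μ z ^ α ∂gaussianReal μ 1 =
      ENNReal.ofReal (Real.exp (α * (α - 1) * μ ^ 2 / 2)) := by
  have h : ∀ z, gaussRatio μ z ^ α =
      ENNReal.ofReal (Real.exp (α * μ ^ 2 / 2) * Real.exp (-(α * μ) * z)) := fun z => by
    rw [gaussRatio, ENNReal.ofReal_rpow_of_pos (Real.exp_pos _), ← Real.exp_mul, ← Real.exp_add]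
    congr 2; ring
  simp_rw [h]
  have hm := congrFun (mgf_id_gaussianReal (μ := μ) (v := 1)) (-(α * μ))
  simp only [mgf, id] at hm
  rw [← ofReal_integral_eq_lintegral_ofReal ((integrable_exp_mul_gaussianReal _).const_mul _)
    (.of_forall fun z => by positivity), integral_const_mul, hm, ← Real.exp_add]
  congr 2; push_cast; ring

/-- Hölder's inequality against the kernel bounds each term `P(y)^α Q(y)^(1-α)` by its share of the
Gaussian integral of order `α`. -/
lemma GaussSim.renyiDiv_le {Ω : Type*} [Countable Ω] {μ : ℝ} {P Q : PMF Ω} (h : GaussSim μ P Q)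
    {α : ℝ} (hα : 1 < α) : renyiDiv α P Q ≤ ((μ ^ 2 / 2 * α : ℝ) : EReal) := by
  obtain ⟨k, hk, hP, hQ⟩ := h
  have hα0 : 0 < α := by linarith
  have hpq : α.HolderConjugate (α / (α - 1)) := Real.HolderConjugate.conjExponent hα
  have hL := measurable_gaussRatio μ
  have term : ∀ y, P y ^ α * Q y ^ (1 - α) ≤
      ∫⁻ z, k z y * gaussRatio μ z ^ α ∂gaussianReal μ 1 := by
    intro y
    set J := ∫⁻ z, k z y * gaussRatio μ z ^ α ∂gaussianReal μ 1
    have hol : P y ≤ J ^ (1 / α) * Q y ^ (1 - 1 / α) := by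
      have := ENNReal.lintegral_mul_le_Lp_mul_Lq (gaussianReal μ 1) hpq
        (f := fun z => k z y ^ (1 / α) * gaussRatio μ z) (g := fun z => k z y ^ (1 - 1 / α))
        (((hk y).pow_const _).mul hL).aemeasurable ((hk y).pow_const _).aemeasurable
      have e1 : 1 / (α / (α - 1)) = 1 - 1 / α := by field_simp
      have e2 : (1 - 1 / α) * (α / (α - 1)) = 1 := by
        have : α - 1 ≠ 0 := by linarith
        field_simp
      have e3 : 0 ≤ 1 - 1 / α := by
        rw [sub_nonneg, div_le_one hα0]; exact hα.le
      rw [hP y, lintegral_gaussianReal_zero μ (hk y), hQ y]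
      convert this using 1
      · refine lintegral_congr fun z => ?_
        simp only [Pi.mul_apply]
        rw [mul_right_comm, ← ENNReal.rpow_add_of_nonneg _ _ (by positivity) e3]
        simp
      · simp_rw [e1, ENNReal.mul_rpow_of_nonneg _ _ hα0.le, ← ENNReal.rpow_mul, e2,
          one_div_mul_cancel hα0.ne', ENNReal.rpow_one]
        rfl
    have hpow : P y ^ α ≤ J * Q y ^ (α - 1) := by
      calc P y ^ α ≤ (J ^ (1 / α) * Q y ^ (1 - 1 / α)) ^ α := ENNReal.rpow_le_rpow hol hα0.le
        _ = J * Q y ^ (α - 1) := by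
          rw [ENNReal.mul_rpow_of_nonneg _ _ hα0.le, ← ENNReal.rpow_mul, ← ENNReal.rpow_mul,
            one_div_mul_cancel hα0.ne', ENNReal.rpow_one, sub_mul, one_div_mul_cancel hα0.ne',
            one_mul]
    by_cases hQ0 : Q y = 0
    · have : P y ^ α = 0 := by
        have := hpow
        rw [hQ0, ENNReal.zero_rpow_of_pos (by linarith), mul_zero] at this
        exact le_antisymm this zero_le
      rw [this, zero_mul]; exact zero_le
    · calc P y ^ α * Q y ^ (1 - α) ≤ J * Q y ^ (α - 1) * Q y ^ (1 - α) := by gcongr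
        _ = J := by
          rw [mul_assoc, ← ENNReal.rpow_add _ _ hQ0 (PMF.apply_ne_top _ _)]
          simp
  have hsum : ∑' y, P y ^ α * Q y ^ (1 - α) ≤
      ENNReal.ofReal (Real.exp (α * (α - 1) * μ ^ 2 / 2)) := by
    refine (ENNReal.tsum_le_tsum term).trans_eq ?_
    rw [← lintegral_tsum (f := fun y z => k z y * gaussRatio μ z ^ α)
        fun y => ((hk y).mul (hL.pow_const _)).aemeasurable,
      ← lintegral_gaussRatio_rpow]
    refine lintegral_congr fun z => ?_
    rw [ENNReal.tsum_mul_right, PMF.tsum_coe, one_mul]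
  have hlog := ENNReal.log_monotone hsum
  rw [ENNReal.log_ofReal_of_pos (Real.exp_pos _), Real.log_exp] at hlog
  have hpos : 0 ≤ (α - 1)⁻¹ := inv_nonneg.2 (by linarith)
  refine (mul_le_mul_of_nonneg_left hlog (EReal.coe_nonneg.2 hpos)).trans_eq ?_
  rw [← EReal.coe_mul]
  congr 1
  have : α - 1 ≠ 0 := by linarith
  field_simp

/-! ### Noisy binary search by multiplicative weights -/

section Search

variable {Y : Type*} [LinearOrder Y]

/-- The factor by which the weight of `y` changes when the query `m` receives the pair of answers
`o`: `(true, true)` says that the target is above `m`, `(false, false)` that it is below `m`, and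
any other pair is read as `m` itself being the target. -/
noncomputable def updateFactor (m : Y) (o : Bool × Bool) (y : Y) : ℝ :=
  match o with
  | (true, true) => if m < y then 5 / 4 else 3 / 4
  | (false, false) => if y < m then 5 / 4 else 3 / 4
  | _ => if y = m then 1 else 3 / 4

lemma updateFactor_pos (m : Y) (o : Bool × Bool) (y : Y) : 0 < updateFactor m o y := by
  rcases o with ⟨_ | _, _ | _⟩ <;> simp only [updateFactor] <;> split_ifs <;> norm_num

variable [Fintype Y]

/-- `m` is a weighted median: at most half of the weight lies strictly on either side. -/
def IsWeightedMedian (w : Y → ℝ) (m : Y) : Prop :=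
  2 * ∑ y with y < m, w y ≤ ∑ y, w y ∧ 2 * ∑ y with m < y, w y ≤ ∑ y, w y

lemma exists_isWeightedMedian [Nonempty Y] {w : Y → ℝ} (hw : ∀ y, 0 ≤ w y) :
    ∃ m, IsWeightedMedian w m := by
  -- the least `m` for which the part up to `m` has at least half of the weight
  obtain ⟨m, hm, hmin⟩ : ∃ m, Minimal (fun m => ∑ y, w y ≤ 2 * ∑ y with y ≤ m, w y) m := by
    have hne : ∃ m, ∑ y, w y ≤ 2 * ∑ y with y ≤ m, w y := by
      obtain ⟨M, hM⟩ := Finite.exists_max (id : Y → Y)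
      refine ⟨M, ?_⟩
      rw [Finset.filter_true_of_mem (p := (· ≤ M)) fun y _ => hM y]
      linarith [Finset.sum_nonneg fun y (_ : y ∈ Finset.univ) => hw y]
    exact (Set.toFinite {m | ∑ y, w y ≤ 2 * ∑ y with y ≤ m, w y}).exists_minimal hne
  refine ⟨m, ?_, ?_⟩
  · rcases (Finset.univ.filter (· < m)).eq_empty_or_nonempty with h | h
    · rw [h]; simpa using Finset.sum_nonneg fun y _ => hw y
    · obtain ⟨p, hp, hpm⟩ := (Finset.univ.filter (· < m)).exists_max_image id h
      have hp' : p < m := by simpa using hp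
      have : (Finset.univ.filter (· < m)) = Finset.univ.filter (· ≤ p) := by
        ext y
        simp only [Finset.mem_filter, Finset.mem_univ, true_and]
        exact ⟨fun hy => hpm y (by simpa using hy), fun hy => hy.trans_lt hp'⟩
      rw [this]
      by_contra hcon
      exact (hmin (not_le.1 hcon).le hp'.le).not_gt hp'
  · have := Finset.sum_filter_add_sum_filter_not Finset.univ (· ≤ m) w
    simp only [not_le] at this
    linarith

/-- A chosen weighted median (an arbitrary element if there is none). -/
noncomputable def weightedMedian [Nonempty Y] (w : Y → ℝ) : Y :=
  Classical.epsilon (IsWeightedMedian w)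

lemma isWeightedMedian_weightedMedian [Nonempty Y] {w : Y → ℝ} (hw : ∀ y, 0 ≤ w y) :
    IsWeightedMedian w (weightedMedian w) :=
  Classical.epsilon_spec (exists_isWeightedMedian hw)

lemma sum_mul_updateFactor_le {w : Y → ℝ} (hw : ∀ y, 0 ≤ w y) {m : Y} (hm : IsWeightedMedian w m)
    (o : Bool × Bool) : ∑ y, w y * updateFactor m o y ≤ ∑ y, w y := by
  have side : ∀ (p : Y → Prop) [DecidablePred p], 2 * ∑ y with p y, w y ≤ ∑ y, w y →
      ∑ y, w y * (if p y then 5 / 4 else 3 / 4) ≤ ∑ y, w y := by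
    intro p _ hp
    have : ∀ y, w y * (if p y then 5 / 4 else 3 / 4 : ℝ) =
        3 / 4 * w y + 1 / 2 * if p y then w y else 0 := fun y => by split_ifs <;> ring
    simp_rw [this]
    rw [Finset.sum_add_distrib, ← Finset.mul_sum, ← Finset.mul_sum, ← Finset.sum_filter]
    linarith
  have stay : ∑ y, w y * (if y = m then 1 else 3 / 4) ≤ ∑ y, w y :=
    Finset.sum_le_sum fun y _ => mul_le_of_le_one_right (hw y) (by split_ifs <;> norm_num)
  rcases o with ⟨_ | _, _ | _⟩
  · exact side (· < m) hm.1
  · exact stay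
  · exact stay
  · exact side (m < ·) hm.2

variable [Nonempty Y]

/-- The weights after the answers `σ` (most recent first), starting from weight `1` everywhere;
every query is a weighted median of the current weights. -/
noncomputable def searchWeight : List (Bool × Bool) → Y → ℝ
  | [] => fun _ => 1
  | o :: σ => fun y => searchWeight σ y * updateFactor (weightedMedian (searchWeight σ)) o y

/-- The query made after the answers `σ`. -/
noncomputable def searchQuery (σ : List (Bool × Bool)) : Y := weightedMedian (searchWeight σ)

/-- How often each element was queried. -/
noncomputable def searchVisits : List (Bool × Bool) → Y → ℕ
  | [] => fun _ => 0
  | _ :: σ => fun y => searchVisits σ y + if y = searchQuery σ then 1 else 0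

/-- The result of the search: a median of all queries. -/
noncomputable def searchOutput (σ : List (Bool × Bool)) : Y :=
  weightedMedian fun y => (searchVisits σ y : ℝ)

lemma searchWeight_pos (σ : List (Bool × Bool)) (y : Y) : 0 < searchWeight σ y := by
  induction σ with
  | nil => exact one_pos
  | cons o σ ih => exact mul_pos ih (updateFactor_pos _ _ _)

lemma searchWeight_le_card (σ : List (Bool × Bool)) (y : Y) :
    searchWeight σ y ≤ Fintype.card Y := by
  have : ∑ y : Y, searchWeight σ y ≤ Fintype.card Y := by
    induction σ with
    | nil => simp [searchWeight]
    | cons o σ ih =>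
      have hw : ∀ y : Y, 0 ≤ searchWeight σ y := fun y => (searchWeight_pos σ y).le
      exact (sum_mul_updateFactor_le hw (isWeightedMedian_weightedMedian hw) o).trans ih
  exact (Finset.single_le_sum (fun y _ => (searchWeight_pos σ y).le) (Finset.mem_univ y)).trans this

lemma sum_searchVisits_cons (s : Finset Y) (o : Bool × Bool) (σ : List (Bool × Bool)) :
    ∑ y ∈ s, searchVisits (o :: σ) y =
      ∑ y ∈ s, searchVisits σ y + if searchQuery σ ∈ s then 1 else 0 := by
  simp [searchVisits, Finset.sum_add_distrib]

lemma sum_searchVisits (σ : List (Bool × Bool)) : ∑ y : Y, searchVisits σ y = σ.length := by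
  induction σ with
  | nil => simp [searchVisits]
  | cons o σ ih => rw [sum_searchVisits_cons, ih]; simp

/-- The inverse weight of the target `c`, divided by `82/100` for every query in `bad` and by
`6/5` for every other query. These constants bound the expected one-step growth of the inverse
weight in the two cases, so the potential is a supermartingale along the search. -/
noncomputable def searchPotential (bad : Finset Y) (c : Y) (σ : List (Bool × Bool)) : ℝ :=
  (searchWeight σ c)⁻¹ * (100 / 82) ^ (∑ y ∈ bad, searchVisits σ y) *
    (5 / 6) ^ (∑ y ∈ badᶜ, searchVisits σ y)

lemma searchPotential_nonneg (bad : Finset Y) (c : Y) (σ : List (Bool × Bool)) :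
    0 ≤ searchPotential bad c σ := by
  have := (searchWeight_pos σ c).le
  unfold searchPotential; positivity

lemma searchPotential_cons (bad : Finset Y) (c : Y) (o : Bool × Bool) (σ : List (Bool × Bool)) :
    searchPotential bad c (o :: σ) = searchPotential bad c σ *
      ((updateFactor (searchQuery σ) o c)⁻¹ *
        if searchQuery σ ∈ bad then 100 / 82 else 5 / 6) := by
  unfold searchPotential
  rw [sum_searchVisits_cons, sum_searchVisits_cons, searchWeight, mul_inv, ← searchQuery]
  by_cases h : searchQuery σ ∈ bad <;> simp [h, pow_succ] <;> ring

/-- If the output lies in the initial part `low` or in the final part `high`, then at least half of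
the queries are bad, which makes the potential exponentially large. The constant is chosen with `(124/125)² ≥ 82/100 · 6/5`. -/
lemma le_searchPotential {low high : Finset Y} (hlow : IsLowerSet (low : Set Y))
    (hhigh : IsUpperSet (high : Set Y)) (c : Y) {σ : List (Bool × Bool)}
    (hσ : searchOutput σ ∈ low ∪ high) :
    (Fintype.card Y : ℝ)⁻¹ * (125 / 124) ^ σ.length ≤ searchPotential (low ∪ high) c σ := by
  set bad := low ∪ high
  set B := ∑ y ∈ bad, searchVisits σ y
  set G := ∑ y ∈ badᶜ, searchVisits σ y
  have hBG : B + G = σ.length := by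
    rw [← sum_searchVisits (Y := Y) σ]; exact Finset.sum_add_sum_compl bad _
  have hmed := isWeightedMedian_weightedMedian (w := fun y : Y => (searchVisits σ y : ℝ))
    fun _ => Nat.cast_nonneg _
  change IsWeightedMedian _ (searchOutput σ) at hmed
  have hle : G ≤ B := by
    rcases Finset.mem_union.1 hσ with h | h
    · have h2 := hmed.2
      have : G ≤ ∑ y : Y with searchOutput σ < y, searchVisits σ y := by
        refine Finset.sum_le_sum_of_subset fun y hy => ?_
        simp only [Finset.mem_filter, Finset.mem_univ, true_and]
        by_contra hcon
        exact Finset.mem_compl.1 hy (Finset.mem_union_left _ (hlow (not_lt.1 hcon) h))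
      simp only [← Nat.cast_sum, sum_searchVisits] at h2
      have h3 : 2 * ∑ y : Y with searchOutput σ < y, searchVisits σ y ≤ σ.length := by exact_mod_cast h2
      omega
    · have h2 := hmed.1
      have : G ≤ ∑ y : Y with y < searchOutput σ, searchVisits σ y := by
        refine Finset.sum_le_sum_of_subset fun y hy => ?_
        simp only [Finset.mem_filter, Finset.mem_univ, true_and]
        by_contra hcon
        exact Finset.mem_compl.1 hy (Finset.mem_union_right _ (hhigh (not_lt.1 hcon) h))
      simp only [← Nat.cast_sum, sum_searchVisits] at h2
      have h3 : 2 * ∑ y : Y with y < searchOutput σ, searchVisits σ y ≤ σ.length := by exact_mod_cast h2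
      omega
  obtain ⟨d, hd⟩ := Nat.exists_eq_add_of_le hle
  have hpow : (125 / 124 : ℝ) ^ σ.length ≤ (100 / 82) ^ B * (5 / 6) ^ G := by
    rw [← hBG, hd, show G + d + G = 2 * G + d by ring, pow_add, pow_add, pow_mul,
      mul_right_comm, ← mul_pow]
    exact mul_le_mul (pow_le_pow_left₀ (by norm_num) (by norm_num) _)
      (pow_le_pow_left₀ (by norm_num) (by norm_num) _) (by positivity) (by positivity)
  unfold searchPotential
  rw [mul_assoc]
  have hw := searchWeight_pos σ c
  have hw' := searchWeight_le_card σ c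
  gcongr

/-! ### The randomised search -/

/-- One step of the search: query `m` is answered by Gaussian threshold bits with means `l m` and
`r m`. -/
noncomputable def searchStep (l r : Y → ℝ) (σ : List (Bool × Bool)) : PMF (List (Bool × Bool)) :=
  (gaussBit (l (searchQuery σ))).bind fun b =>
    (gaussBit (r (searchQuery σ))).bind fun b' => PMF.pure ((b, b') :: σ)

/-- The law of the answers in the first `L` steps. -/
noncomputable def searchRun (l r : Y → ℝ) : ℕ → PMF (List (Bool × Bool))
  | 0 => PMF.pure []
  | L + 1 => (searchRun l r L).bind (searchStep l r)

lemma length_eq_of_searchRun_ne_zero {l r : Y → ℝ} {L : ℕ} {σ : List (Bool × Bool)}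
    (h : searchRun l r L σ ≠ 0) : σ.length = L := by
  induction L generalizing σ with
  | zero =>
    rw [searchRun, ← PMF.mem_support_iff, PMF.mem_support_pure_iff] at h
    simp [h]
  | succ L ih =>
    rw [searchRun, ← PMF.mem_support_iff, PMF.mem_support_bind_iff] at h
    obtain ⟨τ, hτ, h⟩ := h
    simp only [searchStep, PMF.mem_support_bind_iff, PMF.mem_support_pure_iff] at h
    obtain ⟨b, -, b', -, rfl⟩ := h
    simp [ih hτ]

lemma gaussSim_searchRun {l r l' r' : Y → ℝ} {s : ℝ} (hs : 0 < s) (hl : ∀ m, |l' m - l m| ≤ s)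
    (hr : ∀ m, |r' m - r m| ≤ s) (L : ℕ) :
    GaussSim (Real.sqrt (2 * L * s ^ 2)) (searchRun l r L) (searchRun l' r' L) := by
  induction L with
  | zero => exact GaussSim.refl _ _
  | succ L ih =>
    have hstep : ∀ σ, GaussSim (Real.sqrt (2 * s ^ 2)) (searchStep l r σ) (searchStep l' r' σ) := by
      intro σ
      have := (gaussSim_gaussBit hs (hl (searchQuery σ))).bind fun b =>
        (gaussSim_gaussBit hs (hr (searchQuery σ))).bind fun b' =>
          GaussSim.refl 0 (PMF.pure ((b, b') :: σ))
      rw [Real.sq_sqrt (by positivity), zero_pow two_ne_zero, add_zero, ← two_mul] at this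
      exact this
    have := ih.bind hstep
    rw [Real.sq_sqrt (by positivity), Real.sq_sqrt (by positivity)] at this
    convert this using 2 <;> [(push_cast; ring); rfl; rfl]

lemma tsum_bind_mul {A B : Type*} (P : PMF A) (Q : A → PMF B) (f : B → ℝ≥0∞) :
    ∑' b, P.bind Q b * f b = ∑' a, P a * ∑' b, Q a b * f b := by
  simp_rw [PMF.bind_apply, ← ENNReal.tsum_mul_right]
  rw [ENNReal.tsum_comm]
  simp_rw [mul_assoc, ENNReal.tsum_mul_left]

lemma tsum_pure_mul {A : Type*} (a : A) (f : A → ℝ≥0∞) : ∑' b, PMF.pure a b * f b = f a := by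
  rw [tsum_eq_single a fun b hb => by simp [PMF.pure_apply, hb]]
  simp

/-- The means `l, r` of the two bits point towards the target `c`, and with margin `D` when the
query lies in the initial part `low` or in the final part `high`. The left bit asks whether the
target is at least `m`, the right bit whether it is greater than `m`. -/
structure IsSearchTarget (D : ℝ) (l r : Y → ℝ) (low high : Finset Y) (c : Y) : Prop where
  of_lt : ∀ m, m < c → 0 ≤ l m ∧ 0 ≤ r m
  of_gt : ∀ m, c < m → l m ≤ 0 ∧ r m ≤ 0
  of_eq : 0 ≤ l c ∧ r c ≤ 0
  of_low : ∀ m ∈ low, m < c ∧ D ≤ l m ∧ D ≤ r m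
  of_high : ∀ m ∈ high, c < m ∧ l m ≤ -D ∧ r m ≤ -D

/-- The potential is a supermartingale. A bad query gets the correct pair of answers with probability
at least `(99/100)²`. At any other query each bit points in the correct direction with probability
at least `1/2`, so the inverse weight of the target grows by a factor at most `6/5` on average. -/
lemma tsum_searchStep_mul_searchPotential_le {D : ℝ}
    (hD : ∀ h, D ≤ h → 99 / 100 ≤ (gaussBit h true).toReal)
    (hD' : ∀ h, h ≤ -D → (gaussBit h true).toReal ≤ 1 / 100)
    {l r : Y → ℝ} {low high : Finset Y} {c : Y} (H : IsSearchTarget D l r low high c)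
    (σ : List (Bool × Bool)) :
    ∑' τ, searchStep l r σ τ * ENNReal.ofReal (searchPotential (low ∪ high) c τ) ≤
      ENNReal.ofReal (searchPotential (low ∪ high) c σ) := by
  set bad := low ∪ high
  set m : Y := searchQuery σ
  set a := (gaussBit (l m) true).toReal with ha
  set b := (gaussBit (r m) true).toReal with hb
  have bit : ∀ h : ℝ, gaussBit h true = ENNReal.ofReal (gaussBit h true).toReal ∧
      gaussBit h false = ENNReal.ofReal (1 - (gaussBit h true).toReal) := fun h => by
    rw [← toReal_gaussBit_false]
    exact ⟨(ENNReal.ofReal_toReal (PMF.apply_ne_top _ _)).symm,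
      (ENNReal.ofReal_toReal (PMF.apply_ne_top _ _)).symm⟩
  have le_one : ∀ h, (gaussBit h true).toReal ≤ 1 := fun h =>
    ENNReal.toReal_le_of_le_ofReal zero_le_one (by simpa using PMF.coe_le_one _ _)
  have ha0 : 0 ≤ a := ENNReal.toReal_nonneg
  have hb0 : 0 ≤ b := ENNReal.toReal_nonneg
  have ha1 : 0 ≤ 1 - a := sub_nonneg.2 (le_one _)
  have hb1 : 0 ≤ 1 - b := sub_nonneg.2 (le_one _)
  have half : ∀ h, 0 ≤ h → 1 / 2 ≤ (gaussBit h true).toReal := fun h hh =>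
    toReal_gaussBit_true_zero ▸ toReal_gaussBit_true_mono hh
  have half' : ∀ h, h ≤ 0 → (gaussBit h true).toReal ≤ 1 / 2 := fun h hh =>
    toReal_gaussBit_true_zero ▸ toReal_gaussBit_true_mono hh
  set V := searchPotential bad c σ
  have hV : 0 ≤ V := searchPotential_nonneg _ _ _
  set e := (if m ∈ bad then 100 / 82 else 5 / 6 : ℝ) with he
  have he0 : 0 ≤ e := by rw [he]; split_ifs <;> norm_num
  -- the expected inverse update factor of the target
  have main : (a * (b * (updateFactor m (true, true) c)⁻¹ +
      (1 - b) * (updateFactor m (true, false) c)⁻¹) +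
      (1 - a) * (b * (updateFactor m (false, true) c)⁻¹ +
      (1 - b) * (updateFactor m (false, false) c)⁻¹)) * e ≤ 1 := by
    rcases lt_trichotomy m c with hmc | hmc | hmc
    · have h1 := half _ (H.of_lt m hmc).1
      have h2 := half _ (H.of_lt m hmc).2
      rw [← ha] at h1; rw [← hb] at h2
      simp only [updateFactor, hmc, hmc.ne', not_lt_of_gt hmc, if_true, if_false]
      by_cases hm : m ∈ bad
      · rw [he, if_pos hm]
        rcases Finset.mem_union.1 hm with h | h
        · have h1 := hD _ (H.of_low m h).2.1
          have h2 := hD _ (H.of_low m h).2.2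
          rw [← ha] at h1; rw [← hb] at h2
          have : 99 / 100 * (99 / 100) ≤ a * b := by gcongr
          linarith
        · exact absurd (H.of_high m h).1 (not_lt_of_gt hmc)
      · rw [he, if_neg hm]
        have : 1 / 2 * (1 / 2) ≤ a * b := by gcongr
        linarith
    · have hm : m ∉ bad := fun hm => by
        rcases Finset.mem_union.1 hm with h | h
        · exact (H.of_low m h).1.ne hmc
        · exact (H.of_high m h).1.ne' hmc
      have h1 := half _ H.of_eq.1
      have h2 := half' _ H.of_eq.2
      rw [← hmc, ← ha] at h1; rw [← hmc, ← hb] at h2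
      rw [he, if_neg hm]
      simp only [updateFactor, hmc, lt_irrefl, if_true, if_false]
      nlinarith [mul_nonneg (sub_nonneg.2 h1) (sub_nonneg.2 h2)]
    · have h1 := half' _ (H.of_gt m hmc).1
      have h2 := half' _ (H.of_gt m hmc).2
      rw [← ha] at h1; rw [← hb] at h2
      simp only [updateFactor, hmc, hmc.ne, not_lt_of_gt hmc, if_true, if_false]
      by_cases hm : m ∈ bad
      · rw [he, if_pos hm]
        rcases Finset.mem_union.1 hm with h | h
        · exact absurd (H.of_low m h).1 (not_lt_of_gt hmc)
        · have h1 := hD' _ (H.of_high m h).2.1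
          have h2 := hD' _ (H.of_high m h).2.2
          rw [← ha] at h1; rw [← hb] at h2
          have : 99 / 100 * (99 / 100) ≤ (1 - a) * (1 - b) := by gcongr <;> linarith
          linarith
      · rw [he, if_neg hm]
        have : 1 / 2 * (1 / 2) ≤ (1 - a) * (1 - b) := by gcongr <;> linarith
        linarith
  have hf : ∀ o, 0 ≤ (updateFactor m o c)⁻¹ := fun o => (inv_pos.2 (updateFactor_pos m o c)).le
  calc ∑' τ, searchStep l r σ τ * ENNReal.ofReal (searchPotential bad c τ)
      = ENNReal.ofReal (V * ((a * (b * (updateFactor m (true, true) c)⁻¹ +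
          (1 - b) * (updateFactor m (true, false) c)⁻¹) +
          (1 - a) * (b * (updateFactor m (false, true) c)⁻¹ +
          (1 - b) * (updateFactor m (false, false) c)⁻¹)) * e)) := by
        simp only [searchStep, tsum_bind_mul, tsum_pure_mul, tsum_bool, searchPotential_cons]
        rw [(bit (l m)).1, (bit (l m)).2, (bit (r m)).1, (bit (r m)).2, ← ha, ← hb]
        have hn : ∀ o, 0 ≤ V * ((updateFactor m o c)⁻¹ * e) := fun o =>
          mul_nonneg hV (mul_nonneg (hf o) he0)
        have comb : ∀ {p q x y : ℝ}, 0 ≤ p → 0 ≤ q → 0 ≤ x → 0 ≤ y →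
            ENNReal.ofReal p * ENNReal.ofReal x + ENNReal.ofReal q * ENNReal.ofReal y =
              ENNReal.ofReal (p * x + q * y) := fun hp hq hx hy => by
          rw [ENNReal.ofReal_add (mul_nonneg hp hx) (mul_nonneg hq hy), ENNReal.ofReal_mul hp,
            ENNReal.ofReal_mul hq]
        rw [comb hb1 hb0 (hn (false, false)) (hn (false, true)),
          comb hb1 hb0 (hn (true, false)) (hn (true, true)),
          comb ha1 ha0 (add_nonneg (mul_nonneg hb1 (hn _)) (mul_nonneg hb0 (hn _)))
            (add_nonneg (mul_nonneg hb1 (hn _)) (mul_nonneg hb0 (hn _)))]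
        congr 1; ring
    _ ≤ ENNReal.ofReal V := ENNReal.ofReal_le_ofReal (mul_le_of_le_one_right hV main)

lemma tsum_searchRun_mul_searchPotential_le {D : ℝ}
    (hD : ∀ h, D ≤ h → 99 / 100 ≤ (gaussBit h true).toReal)
    (hD' : ∀ h, h ≤ -D → (gaussBit h true).toReal ≤ 1 / 100)
    {l r : Y → ℝ} {low high : Finset Y} {c : Y} (H : IsSearchTarget D l r low high c) (L : ℕ) :
    ∑' σ, searchRun l r L σ * ENNReal.ofReal (searchPotential (low ∪ high) c σ) ≤ 1 := by
  induction L with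
  | zero => simp [searchRun, searchPotential, searchWeight, searchVisits]
  | succ L ih =>
    rw [searchRun, tsum_bind_mul]
    exact (ENNReal.tsum_le_tsum fun σ => mul_le_mul_right
      (tsum_searchStep_mul_searchPotential_le hD hD' H σ) _).trans ih

/-- The search rarely ends in `low` or `high`, by Markov's inequality for the potential. -/
lemma one_sub_le_searchOutput [MeasurableSpace Y] [MeasurableSingletonClass Y] {D : ℝ}
    (hD : ∀ h, D ≤ h → 99 / 100 ≤ (gaussBit h true).toReal)
    (hD' : ∀ h, h ≤ -D → (gaussBit h true).toReal ≤ 1 / 100)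
    {l r : Y → ℝ} {low high : Finset Y} {c : Y} (H : IsSearchTarget D l r low high c)
    (hlow : IsLowerSet (low : Set Y)) (hhigh : IsUpperSet (high : Set Y)) (L : ℕ) :
    1 - Fintype.card Y * (124 / 125 : ℝ) ^ L ≤
      ((searchRun l r L).map searchOutput).toMeasure.real ((low ∪ high : Finset Y) : Set Y)ᶜ := by
  have hN : 0 < (Fintype.card Y : ℝ) := by exact_mod_cast Fintype.card_pos
  set δ : ℝ := Fintype.card Y * (124 / 125 : ℝ) ^ L with hδ
  have hδ0 : 0 ≤ δ := by positivity
  have hbad : ((searchRun l r L).map searchOutput).toMeasure ((low ∪ high : Finset Y) : Set Y) ≤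
      ENNReal.ofReal δ := by
    rw [PMF.toMeasure_apply_eq_toOuterMeasure, PMF.toOuterMeasure_map_apply,
      PMF.toOuterMeasure_apply]
    have hterm : ∀ σ, Set.indicator (searchOutput ⁻¹' ((low ∪ high : Finset Y) : Set Y))
        (searchRun l r L) σ ≤
        searchRun l r L σ * ENNReal.ofReal (searchPotential (low ∪ high) c σ) *
          ENNReal.ofReal δ := by
      intro σ
      by_cases hσ : searchOutput σ ∈ low ∪ high
      · by_cases h0 : searchRun l r L σ = 0
        · rw [Set.indicator_apply_eq_zero.2 fun _ => h0]; exact zero_le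
        · have hV := le_searchPotential hlow hhigh c hσ
          rw [length_eq_of_searchRun_ne_zero h0] at hV
          have h1 : (1 : ℝ) ≤ searchPotential (low ∪ high) c σ * δ := by
            calc (1 : ℝ) = (Fintype.card Y : ℝ)⁻¹ * (125 / 124) ^ L * δ := by
                  rw [hδ, mul_mul_mul_comm, inv_mul_cancel₀ hN.ne', ← mul_pow]; norm_num
              _ ≤ _ := by gcongr
          rw [Set.indicator_of_mem (by exact hσ), mul_assoc,
            ← ENNReal.ofReal_mul (searchPotential_nonneg _ _ _)]
          exact le_mul_of_one_le_right zero_le (by simpa using h1)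
      · rw [Set.indicator_of_notMem (by exact hσ)]; exact zero_le
    refine (ENNReal.tsum_le_tsum hterm).trans ?_
    rw [ENNReal.tsum_mul_right]
    exact mul_le_of_le_one_left zero_le (tsum_searchRun_mul_searchPotential_le hD hD' H L)
  rw [probReal_compl_eq_one_sub (Finset.measurableSet _)]
  have := ENNReal.toReal_le_of_le_ofReal hδ0 hbad
  rw [measureReal_def]; linarith

end Search

/-! ### The score of a threshold -/

section Score

variable {n k : ℕ} {Y : Type*}

/-- The least size of a set `T` such that every block containing `T` has its value in `D`, capped at
`t + 1`. -/
noncomputable def coverScore (t : ℕ) (S : Fin k → Finset (Fin n)) (v : Fin k → Y) (D : Set Y) : ℕ :=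
  sInf (insert (t + 1) {c | ∃ T : Finset (Fin n), T.card = c ∧ ∀ i, T ⊆ S i → v i ∈ D})

lemma coverScore_le_cap (t : ℕ) (S : Fin k → Finset (Fin n)) (v : Fin k → Y) (D : Set Y) :
    coverScore t S v D ≤ t + 1 :=
  Nat.sInf_le (Set.mem_insert _ _)

lemma coverScore_le_card {t : ℕ} {S : Fin k → Finset (Fin n)} {v : Fin k → Y} {D : Set Y}
    {T : Finset (Fin n)} (hT : ∀ i, T ⊆ S i → v i ∈ D) : coverScore t S v D ≤ T.card :=
  Nat.sInf_le (Set.mem_insert_of_mem _ ⟨T, rfl, hT⟩)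

lemma coverScore_eq_cap_or (t : ℕ) (S : Fin k → Finset (Fin n)) (v : Fin k → Y) (D : Set Y) :
    coverScore t S v D = t + 1 ∨
      ∃ T : Finset (Fin n), T.card = coverScore t S v D ∧ ∀ i, T ⊆ S i → v i ∈ D :=
  Nat.sInf_mem (Set.insert_nonempty (t + 1)
    {c | ∃ T : Finset (Fin n), T.card = c ∧ ∀ i, T ⊆ S i → v i ∈ D})

lemma coverScore_eq_zero {t : ℕ} {S : Fin k → Finset (Fin n)} {v : Fin k → Y} {D : Set Y}
    (h : ∀ i, v i ∈ D) : coverScore t S v D = 0 := by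
  simpa using coverScore_le_card (t := t) (S := S) (T := ∅) fun i _ => h i

lemma coverScore_eq_cap {m t : ℕ} {S : Fin k → Finset (Fin n)} (hS : IsCoveringDesign n m t S)
    {v : Fin k → Y} {D : Set Y} (h : ∀ i, v i ∉ D) : coverScore t S v D = t + 1 := by
  rcases coverScore_eq_cap_or t S v D with h' | ⟨T, hT, hTD⟩
  · exact h'
  · refine le_antisymm (coverScore_le_cap t S v D) ?_
    by_contra hlt
    obtain ⟨i, hi⟩ := hS.2 T (by omega)
    exact h i (hTD i hi)

lemma coverScore_anti (t : ℕ) (S : Fin k → Finset (Fin n)) (v : Fin k → Y) {D D' : Set Y}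
    (h : D ⊆ D') : coverScore t S v D' ≤ coverScore t S v D := by
  rcases coverScore_eq_cap_or t S v D with h' | ⟨T, hT, hTD⟩
  · rw [h']; exact coverScore_le_cap t S v D'
  · rw [← hT]; exact coverScore_le_card fun i hi => h (hTD i hi)

/-- Adding the index `j` to `T` leaves only blocks on which the two vectors of values agree. -/
lemma coverScore_le_add_one (t : ℕ) {S : Fin k → Finset (Fin n)} {v v' : Fin k → Y} {j : Fin n}
    (h : ∀ i, j ∈ S i → v i = v' i) (D : Set Y) : coverScore t S v' D ≤ coverScore t S v D + 1 := by
  classical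
  rcases coverScore_eq_cap_or t S v D with h' | ⟨T, hT, hTD⟩
  · have := coverScore_le_cap t S v' D; omega
  · refine (coverScore_le_card (T := insert j T) fun i hi => ?_).trans
      (hT ▸ Finset.card_insert_le j T)
    rw [Finset.insert_subset_iff] at hi
    exact h i hi.1 ▸ hTD i hi.2

/-- The score in units of the noise, centred at the middle of its range. -/
noncomputable def centredScore (s : ℝ) (t : ℕ) (S : Fin k → Finset (Fin n)) (v : Fin k → Y)
    (D : Set Y) : ℝ :=
  s * (coverScore t S v D - (t + 1) / 2)

lemma abs_centredScore_sub_le {s : ℝ} (hs : 0 ≤ s) (t : ℕ) {S : Fin k → Finset (Fin n)}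
    {v v' : Fin k → Y} {j : Fin n} (h : ∀ i, j ∈ S i → v i = v' i) (D : Set Y) :
    |centredScore s t S v' D - centredScore s t S v D| ≤ s := by
  have h1 : (coverScore t S v' D : ℝ) ≤ coverScore t S v D + 1 := by
    exact_mod_cast coverScore_le_add_one t h D
  have h2 : (coverScore t S v D : ℝ) ≤ coverScore t S v' D + 1 := by
    exact_mod_cast coverScore_le_add_one t (fun i hi => (h i hi).symm) D
  unfold centredScore
  rw [← mul_sub, abs_mul, abs_of_nonneg hs]
  exact mul_le_of_le_one_right hs (abs_le.2 ⟨by linarith, by linarith⟩)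

/-- The target is the least `c` for which the score of `Iic c` is at most half of the cap. -/
lemma exists_isSearchTarget [Fintype Y] [LinearOrder Y] {m t : ℕ} {S : Fin k → Finset (Fin n)}
    (hS : IsCoveringDesign n m t S) (v : Fin k → Y) {s D : ℝ} (hs : 0 < s)
    (hD : D ≤ s * ((t + 1) / 2)) :
    ∃ c, IsSearchTarget D (fun y => centredScore s t S v (Set.Iio y))
      (fun y => centredScore s t S v (Set.Iic y))
      {y | ∀ i, y < v i} {y | ∀ i, v i < y} c := by
  classical
  have nonneg : ∀ A : Set Y, (t + 1 : ℝ) ≤ 2 * coverScore t S v A → 0 ≤ centredScore s t S v A :=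
    fun A hA => mul_nonneg hs.le (by linarith)
  have nonpos : ∀ A : Set Y, 2 * coverScore t S v A ≤ (t + 1 : ℝ) → centredScore s t S v A ≤ 0 :=
    fun A hA => mul_nonpos_of_nonneg_of_nonpos hs.le (by linarith)
  have anti : ∀ {A B : Set Y}, A ⊆ B → (coverScore t S v B : ℝ) ≤ coverScore t S v A :=
    fun h => by exact_mod_cast coverScore_anti t S v h
  have hk : Nonempty (Fin k) := ⟨(hS.2 ∅ (by simp)).choose⟩
  obtain ⟨M, hM⟩ := Finite.exists_max v
  obtain ⟨c, hc, hmin⟩ := (Set.toFinite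
    {y | 2 * (coverScore t S v (Set.Iic y) : ℝ) ≤ t + 1}).exists_minimal ⟨v M, by
      rw [Set.mem_ofPred_eq, coverScore_eq_zero (D := Set.Iic (v M)) fun i => hM i]
      simp; positivity⟩
  rw [Set.mem_ofPred_eq] at hc
  have below : ∀ y, y < c → (t + 1 : ℝ) ≤ 2 * coverScore t S v (Set.Iic y) := fun y hy => by
    by_contra hcon
    exact (hmin (not_le.1 hcon).le hy.le).not_gt hy
  have hc' : (t + 1 : ℝ) ≤ 2 * coverScore t S v (Set.Iio c) := by
    rcases (Set.Iio c).eq_empty_or_nonempty with h | h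
    · rw [coverScore_eq_cap hS fun i => by rw [h]; simp]
      push_cast; linarith [Nat.cast_nonneg (α := ℝ) t]
    · obtain ⟨p, hp⟩ := (Set.toFinite (Set.Iio c)).exists_maximal h
      refine (below p hp.1).trans (mul_le_mul_of_nonneg_left (anti fun y hy => ?_) zero_le_two)
      exact (le_total y p).elim id fun h => hp.2 hy h
  refine ⟨c, fun y hy => ⟨nonneg _ ?_, nonneg _ (below y hy)⟩,
    fun y hy => ⟨nonpos _ ?_, nonpos _ ?_⟩, ⟨nonneg _ hc', nonpos _ hc⟩,
    fun y hy => ?_, fun y hy => ?_⟩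
  · have := anti (Set.Iio_subset_Iic_self (a := y)); linarith [below y hy]
  · have := anti (Set.Iic_subset_Iio.2 hy); linarith
  · have := anti (Set.Iic_subset_Iic.2 hy.le); linarith
  · simp only [Finset.mem_filter, Finset.mem_univ, true_and] at hy
    have h1 : coverScore t S v (Set.Iic y) = t + 1 :=
      coverScore_eq_cap hS fun i hi => (hy i).not_ge hi
    have h2 : coverScore t S v (Set.Iio y) = t + 1 :=
      coverScore_eq_cap hS fun i hi => (hy i).not_gt hi
    refine ⟨?_, ?_, ?_⟩
    · by_contra hcon
      have := anti (Set.Iic_subset_Iic.2 (not_lt.1 hcon))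
      rw [h1] at this; push_cast at this
      linarith [Nat.cast_nonneg (α := ℝ) t]
    · unfold centredScore; rw [h2]; push_cast; linarith
    · unfold centredScore; rw [h1]; push_cast; linarith
  · simp only [Finset.mem_filter, Finset.mem_univ, true_and] at hy
    have h1 : coverScore t S v (Set.Iic y) = 0 := coverScore_eq_zero fun i => (hy i).le
    have h2 : coverScore t S v (Set.Iio y) = 0 := coverScore_eq_zero fun i => hy i
    refine ⟨?_, ?_, ?_⟩
    · by_contra hcon
      have := anti (Set.Iio_subset_Iio (not_lt.1 hcon))
      rw [h2] at this; push_cast at this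
      linarith [Nat.cast_nonneg (α := ℝ) t]
    · unfold centredScore; rw [h2]; push_cast; linarith
    · unfold centredScore; rw [h1]; push_cast; linarith

end Score

/-! ### Covering designs and neighbouring data sets -/

lemma exists_isCoveringDesign {n m t k : ℕ} (hmn : m ≤ n) (htm : t ≤ m)
    (hk : coveringNumber n m t ≤ k) : ∃ S : Fin k → Finset (Fin n), IsCoveringDesign n m t S := by
  classical
  have hne : {k : ℕ | ∃ S : Fin k → Finset (Fin n), IsCoveringDesign n m t S}.Nonempty := by
    let e := (Finset.univ.powersetCard m : Finset (Finset (Fin n))).equivFin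
    refine ⟨_, fun i => (e.symm i : Finset (Fin n)), fun i => ?_, fun T hT => ?_⟩
    · exact (Finset.mem_powersetCard.1 (e.symm i).2).2
    · obtain ⟨U, hTU, -, hU⟩ := Finset.exists_subsuperset_card_eq (Finset.subset_univ T)
        (hT.trans htm) (by simpa using hmn)
      refine ⟨e ⟨U, Finset.mem_powersetCard.2 ⟨Finset.subset_univ U, hU⟩⟩, ?_⟩
      simpa using hTU
  obtain ⟨S, hS⟩ : ∃ S : Fin (coveringNumber n m t) → Finset (Fin n), IsCoveringDesign n m t S :=
    Nat.sInf_mem hne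
  obtain ⟨i₀, -⟩ := hS.2 ∅ (by simp)
  -- repeat one block to reach size `k`
  refine ⟨fun i => if h : i.1 < coveringNumber n m t then S ⟨i, h⟩ else S i₀, fun i => ?_,
    fun T hT => ?_⟩
  · dsimp only; split_ifs
    · exact hS.1 _
    · exact hS.1 _
  · obtain ⟨i, hi⟩ := hS.2 T hT
    exact ⟨⟨i, i.2.trans_le hk⟩, by simpa using hi⟩

/-- Neighbouring data sets differ in one index only. -/
lemma Neighbouring.exists_index {X : Type*} {bot : X} {n : ℕ} {x x' : Fin n → X}
    (h : Neighbouring bot x x') : ∃ j, ∀ i, i ≠ j → x i = x' i := by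
  have hsub : ∀ i, x i ≠ x' i → i ∈ {i | tupleDiff bot x x' i ≠ bot} ∪
      {i | tupleDiff bot x' x i ≠ bot} := by
    intro i hi
    by_contra hcon
    simp [tupleDiff, hi, hi.symm] at hcon
    exact hi (hcon.1.trans hcon.2.symm)
  have hcard : ({i | tupleDiff bot x x' i ≠ bot} ∪ {i | tupleDiff bot x' x i ≠ bot}).ncard ≤ 1 :=
    (Set.ncard_union_le _ _).trans h.le
  have hne : ({i | tupleDiff bot x x' i ≠ bot} ∪ {i | tupleDiff bot x' x i ≠ bot}).Nonempty := by
    rw [Set.nonempty_iff_ne_empty]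
    intro h0
    rw [Set.union_empty_iff] at h0
    simp [Neighbouring, tupleSize, h0.1, h0.2] at h
  obtain ⟨j, hj⟩ := hne
  refine ⟨j, fun i hij => ?_⟩
  by_contra hi
  exact hij ((Set.ncard_le_one (Set.toFinite _)).1 hcard i (hsub i hi) j hj)

lemma tupleRestrict_compl_congr {X : Type*} {bot : X} {n : ℕ} {x x' : Fin n → X} {j : Fin n}
    (h : ∀ i, i ≠ j → x i = x' i) {S : Finset (Fin n)} (hj : j ∈ S) :
    tupleRestrict bot x Sᶜ = tupleRestrict bot x' Sᶜ := by
  funext i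
  unfold tupleRestrict
  split_ifs with hi
  · exact h i fun hij => Finset.mem_compl.1 hi (hij ▸ hj)
  · rfl

/-! ### Choice of parameters and the mechanism -/

/-- The number of steps of the search: enough for `N (124/125)^L ≤ β`. -/
noncomputable def searchLength (N : ℕ) (β : ℝ) : ℕ := ⌈125 * Real.log (N / β)⌉₊

lemma card_mul_pow_searchLength_le {N : ℕ} {β : ℝ} (hN : 1 ≤ N) (hβ : 0 < β) :
    N * (124 / 125 : ℝ) ^ searchLength N β ≤ β := by
  have hN' : (0 : ℝ) < N := by exact_mod_cast hN
  have h1 : (124 / 125 : ℝ) ≤ Real.exp (-(1 / 125)) := by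
    linarith [Real.add_one_le_exp (-(1 / 125) : ℝ)]
  have h2 : 125 * Real.log (N / β) ≤ searchLength N β := Nat.le_ceil _
  calc N * (124 / 125 : ℝ) ^ searchLength N β
      ≤ N * Real.exp (-(1 / 125)) ^ searchLength N β := by gcongr
    _ = N * Real.exp (-(searchLength N β / 125)) := by
        rw [← Real.exp_nat_mul]; congr 2; ring
    _ ≤ N * Real.exp (-Real.log (N / β)) := by gcongr; linarith
    _ = β := by rw [Real.exp_neg, Real.exp_log (by positivity)]; field_simp

lemma searchLength_le {N : ℕ} {β : ℝ} (hN : 2 ≤ N) (hβ : 0 < β) (hβ1 : β < 1) :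
    (searchLength N β : ℝ) ≤ 127 * Real.log (N / β) := by
  have hN' : (2 : ℝ) ≤ N := by exact_mod_cast hN
  have h2 : Real.log 2 ≤ Real.log (N / β) := Real.log_le_log two_pos (by
    rw [le_div_iff₀ hβ]; nlinarith)
  have := Real.log_two_gt_d9
  have h3 := (Nat.ceil_lt_add_one (a := 125 * Real.log (N / β)) (by linarith)).le
  unfold searchLength; linarith

lemma searchLength_pos {N : ℕ} {β : ℝ} (hN : 2 ≤ N) (hβ : 0 < β) (hβ1 : β < 1) :
    0 < searchLength N β := by
  have hN' : (2 : ℝ) ≤ N := by exact_mod_cast hN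
  refine Nat.ceil_pos.2 (mul_pos (by norm_num) (Real.log_pos ?_))
  rw [lt_div_iff₀ hβ]; linarith

lemma isZCDP_and_isGDP_of_gaussSim {X Ω : Type*} [Fintype Ω] [MeasurableSpace Ω]
    [MeasurableSingletonClass Ω] {n : ℕ} {bot : X} {ρ : ℝ} (hρ : 0 < ρ)
    {M : (Fin n → X) → PMF Ω}
    (h : ∀ x x', Neighbouring bot x x' → GaussSim (Real.sqrt (2 * ρ)) (M x) (M x')) :
    IsZCDP bot ρ M ∧ IsGDP bot (Real.sqrt (2 * ρ)) M := by
  refine ⟨fun x x' hx α hα => ?_, fun x x' hx a ha => (h x x' hx).tradeoff_le ha.1⟩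
  have := (h x x' hx).renyiDiv_le hα
  rwa [Real.sq_sqrt (by positivity), mul_div_cancel_left₀ _ two_ne_zero] at this

/-- The covering strength `t(N, ρ, β)`; the constant `D` is the margin, in units of the noise, at
which a Gaussian threshold bit is reliable. Rounding down is allowed because the score ranges up to
`t + 1`. No covering property beyond the existence of a block is
needed when there is only one output or when accuracy is void. -/
noncomputable def coverStrength (D : ℝ) (N : ℕ) (ρ β : ℝ) : ℕ :=
  if 2 ≤ N ∧ β < 1 then ⌊2 * D / Real.sqrt (ρ / searchLength N β)⌋₊ else 0

lemma coverStrength_le {D : ℝ} (hD : 0 < D) {N : ℕ} {ρ β : ℝ} (hρ : 0 < ρ) (hβ : 0 < β) :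
    (coverStrength D N ρ β : ℝ) ≤
      2 * D * Real.sqrt 127 * Real.sqrt (1 / ρ * Real.log (N / β)) := by
  unfold coverStrength
  split_ifs with h
  · refine (Nat.floor_le (by positivity)).trans ?_
    rw [mul_assoc, ← Real.sqrt_mul (by norm_num), div_eq_mul_inv, ← Real.sqrt_inv, inv_div]
    gcongr
    rw [div_le_iff₀ hρ]
    have := searchLength_le h.1 hβ h.2
    field_simp
    linarith
  · simp; positivity

theorem mainTheorem6 :
    ∃ (C : ℝ) (t : ℕ → ℝ → ℝ → ℕ), 0 < C ∧
      (∀ (N : ℕ) (ρ β : ℝ), 1 ≤ N → 0 < ρ → 0 < β →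
        (t N ρ β : ℝ) ≤ C * Real.sqrt (1 / ρ * Real.log (N / β))) ∧
      ∀ (X : Type*) (bot : X) (Y : Finset ℝ) (ρ β : ℝ) (n m k : ℕ),
        Y.Nonempty → 0 < ρ → 0 < β →
        m ≤ n → t Y.card ρ β ≤ m → coveringNumber n m (t Y.card ρ β) ≤ k →
        (∃ S : Fin k → Finset (Fin n), IsCoveringDesign n m (t Y.card ρ β) S) ∧
        ∀ S : Fin k → Finset (Fin n), IsCoveringDesign n m (t Y.card ρ β) S →
          ∃ A : (Fin k → Y) → PMF Y,
            ∀ f : (Fin n → X) → Y, ∃ M : (Fin n → X) → PMF Y,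
              -- privacy
              (IsZCDP bot ρ M ∧ IsGDP bot (Real.sqrt (2 * ρ)) M) ∧
              -- accuracy
              (∀ x : Fin n → X, tupleSize bot x = n →
                1 - β ≤ (M x).toMeasure.real
                  {y : Y | (y : ℝ) ≤ (⨆ i, (f (tupleRestrict bot x (S i)ᶜ) : ℝ)) ∧
                    (⨅ i, (f (tupleRestrict bot x (S i)ᶜ) : ℝ)) ≤ (y : ℝ)}) ∧
              -- oracle efficiency
              (∀ x : Fin n → X, M x = A fun i => f (tupleRestrict bot x (S i)ᶜ)) := by
  obtain ⟨D, hD0, hD, hD'⟩ := exists_gaussBit_reliable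
  refine ⟨2 * D * Real.sqrt 127, coverStrength D, by positivity,
    fun N ρ β _ hρ hβ => coverStrength_le hD0 hρ hβ, ?_⟩
  intro X bot Y ρ β n m k hY hρ hβ hmn htm hk
  refine ⟨exists_isCoveringDesign hmn htm hk, fun S hS => ?_⟩
  have : Nonempty Y := hY.to_subtype
  have hcard : Fintype.card Y = Y.card := Fintype.card_coe Y
  -- the elements of `Y` between two of the values are accurate
  have acc : ∀ (v : Fin k → Y) (y : Y), (∃ i, y ≤ v i) → (∃ i, v i ≤ y) →
      (y : ℝ) ≤ (⨆ i, (v i : ℝ)) ∧ (⨅ i, (v i : ℝ)) ≤ (y : ℝ) := by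
    rintro v y ⟨i, hi⟩ ⟨j, hj⟩
    exact ⟨le_ciSup_of_le (Set.finite_range _).bddAbove i hi,
      ciInf_le_of_le (Set.finite_range _).bddBelow j hj⟩
  by_cases hcase : 2 ≤ Y.card ∧ β < 1
  · set t := coverStrength D Y.card ρ β with ht
    set L := searchLength Y.card β with hL
    have hLpos : (0 : ℝ) < L := by exact_mod_cast searchLength_pos hcase.1 hβ hcase.2
    set s := Real.sqrt (ρ / L) with hs
    have hs0 : 0 < s := Real.sqrt_pos.2 (by positivity)
    -- the choice of `t` makes half of the range of the score at least `D` in units of the noise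
    have hmargin : D ≤ s * ((t + 1) / 2) := by
      have h1 : 2 * D / s < t + 1 := by
        rw [ht, coverStrength, if_pos hcase]; exact Nat.lt_floor_add_one _
      rw [div_lt_iff₀ hs0] at h1
      linarith
    let A : (Fin k → Y) → PMF Y := fun v =>
      (searchRun (fun y => centredScore s t S v (Set.Iio y))
        (fun y => centredScore s t S v (Set.Iic y)) L).map searchOutput
    refine ⟨A, fun f => ⟨fun x => A fun i => f (tupleRestrict bot x (S i)ᶜ), ?_, fun x _ => ?_,
      fun _ => rfl⟩⟩
    · refine isZCDP_and_isGDP_of_gaussSim hρ fun x x' hx => ?_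
      obtain ⟨j, hj⟩ := hx.exists_index
      have hv : ∀ i, j ∈ S i →
          f (tupleRestrict bot x (S i)ᶜ) = f (tupleRestrict bot x' (S i)ᶜ) :=
        fun i hi => by rw [tupleRestrict_compl_congr hj hi]
      have hsim := gaussSim_searchRun hs0
        (fun y => abs_centredScore_sub_le hs0.le t hv (Set.Iio y))
        (fun y => abs_centredScore_sub_le hs0.le t hv (Set.Iic y)) L
      have hbudget : 2 * L * s ^ 2 = 2 * ρ := by
        rw [hs, Real.sq_sqrt (by positivity)]; field_simp
      rw [hbudget] at hsim
      exact hsim.map (Real.sqrt_nonneg _) searchOutput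
    · set v : Fin k → Y := fun i => f (tupleRestrict bot x (S i)ᶜ)
      obtain ⟨c, hc⟩ := exists_isSearchTarget hS v hs0 hmargin
      have := one_sub_le_searchOutput hD hD' hc
        (fun a b hab ha => by simp at ha ⊢; exact fun i => hab.trans_lt (ha i))
        (fun a b hab ha => by simp at ha ⊢; exact fun i => (ha i).trans_le hab) L
      rw [hcard] at this
      have hβ' := card_mul_pow_searchLength_le hY.card_pos hβ
      refine (by linarith : 1 - β ≤ _).trans (this.trans ?_)
      refine measureReal_mono fun y hy => acc v y ?_ ?_
      · by_contra! hcon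
        exact hy (by simpa using Or.inr hcon)
      · by_contra! hcon
        exact hy (by simpa using Or.inl hcon)
  · -- only one output, or a void accuracy requirement: a constant output will do
    obtain ⟨y₀⟩ := this
    refine ⟨fun _ => PMF.pure y₀, fun f => ⟨fun _ => PMF.pure y₀,
      isZCDP_and_isGDP_of_gaussSim hρ fun _ _ _ => GaussSim.refl _ _, fun x _ => ?_,
      fun _ => rfl⟩⟩
    rw [not_and_or, not_le, not_lt] at hcase
    rcases hcase with h | h
    · obtain ⟨i₀, -⟩ := hS.2 ∅ (by simp)
      have hsub : ∀ y y' : Y, y = y' := fun y y' =>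
        Fintype.card_le_one_iff.1 (by omega) y y'
      have huniv : {y : Y | (y : ℝ) ≤ (⨆ i, (f (tupleRestrict bot x (S i)ᶜ) : ℝ)) ∧
          (⨅ i, (f (tupleRestrict bot x (S i)ᶜ) : ℝ)) ≤ (y : ℝ)} = Set.univ :=
        Set.eq_univ_of_forall fun y => acc (fun i => f (tupleRestrict bot x (S i)ᶜ)) y
          ⟨i₀, (hsub _ _).le⟩ ⟨i₀, (hsub _ _).le⟩
      rw [huniv, probReal_univ]; linarith
    · exact (sub_nonpos.2 h).trans measureReal_nonneg
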